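/- Let $\mathbb D$ be the open unit disk and $\mathbb T$ the unit circle, and let $L^2=L^2(\mathbb T)$ carry the norm $\|g\|_2=\left(\frac1{2\pi}\int_0^{2\pi}|g(e^{i\theta})|^2\,d\theta\right)^{1/2}$. Let ${\cal R}_{n,n}$ be the set of rational functions $p/q$ with $p,q$ complex polynomials of degree at most $n$, where $q$ has no root on $\mathbb T$, and let $d_2(f,{\cal R}_{n,n})=\inf_{r\in{\cal R}_{n,n}}\|f-r\|_2$. For $|x|<1$ put $\mathrm{Li}_\beta(x)=\sum_{\ell\ge 1}x^\ell/\ell^\beta$. Let $0\le n<N$ be integers and let $f$ be a finite Blaschke product of degree (exactly) $N$, that is $f(z)=c\prod_{i=1}^N\frac{z-\zeta_i}{1-\overline{\zeta_i}z}$ with $|c|=1$ and $\zeta_i\in\mathbb D$. Assume that the modulus of the zeros of $f$ in $\mathbb D$ does not exceed $\lambda\in(0,1)$. Let $0<\alpha<\frac{1-\lambda}{1+\lambda}$ and put $$s^*:=\gamma+\sqrt{\gamma^2-1},\qquad \gamma:=\frac{\alpha^{-1}-1+(\alpha^{-1}+1)\lambda^2}{2\lambda\alpha^{-1}}.$$ Then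 $1<s^*<1/\lambda$. Moreover, setting, for $\beta\in[0,1]$, $$Q(\beta):=\alpha\left(1-\frac nN-\left(\frac{s^*-\lambda}{1-\lambda s^*}\right)^{2N}(n+1)^\beta\,\mathrm{Li}_\beta\big((s^*)^{-2}\big)\,\frac{(s^*)^{2(2-[N/\alpha])}}{N\,((s^*)^2-1)^2}\right),$$ where $[N/\alpha]$ is the integer part of $N/\alpha$, one has $$d_2(f,{\cal R}_{n,n})\ \ge\ \sup_{\beta}\ \sqrt{Q(\beta)},$$ the supremum being taken over those $\beta\in[0,1]$ for which $Q(\beta)\ge 0$ (no claim is made when there is no such $\beta$). -/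

import Mathlib

open scoped ENNReal ComplexConjugate

namespace BlaschkeApprox

/-- The period `2π` is positive. -/
instance factTwoPiPos : Fact (0 < 2 * Real.pi) := ⟨Real.two_pi_pos⟩

/-- The norm of `g` in `L²(𝕋)`, that is `((1/2π) ∫₀^{2π} |g(e^{iθ})|² dθ)^{1/2}`, with values in
`[0, ∞]`. The measure is the normalized Lebesgue measure on `ℝ / 2πℤ`, and `g` is restricted
to the unit circle through `θ ↦ e^{iθ}`. -/
noncomputable def normL2 (g : ℂ → ℂ) : ℝ≥0∞ :=
  MeasureTheory.eLpNorm
    (fun θ : AddCircle (2 * Real.pi) => g ((AddCircle.toCircle θ : Circle) : ℂ)) 2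
    AddCircle.haarAddCircle

/-- The distance in `L²(𝕋)` from `f` to a set `S` of functions. -/
noncomputable def d₂ (f : ℂ → ℂ) (S : Set (ℂ → ℂ)) : ℝ≥0∞ :=
  ⨅ r ∈ S, normL2 (fun z => f z - r z)

/-- The rational functions `p / q` of type `(m, n)`, with `deg p ≤ m` and `deg q ≤ n`, whose
denominator `q` has no root on the unit circle. Poles in the open unit disk are allowed. -/
def ratFun (m n : ℕ) : Set (ℂ → ℂ) :=
  {r | ∃ p q : Polynomial ℂ, p.natDegree ≤ m ∧ q.natDegree ≤ n ∧
    (∀ z : ℂ, ‖z‖ = 1 → q.eval z ≠ 0) ∧ r = fun z => p.eval z / q.eval z}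

/-- `f` is, on the closed unit disk, a finite Blaschke product of degree exactly `N`. -/
def IsBlaschkeProduct (N : ℕ) (f : ℂ → ℂ) : Prop :=
  ∃ (c : ℂ) (ζ : Fin N → ℂ), ‖c‖ = 1 ∧ (∀ i, ‖ζ i‖ < 1) ∧
    ∀ z : ℂ, ‖z‖ ≤ 1 → f z = c * ∏ i, (z - ζ i) / (1 - conj (ζ i) * z)

/-- The polylogarithm `Li_β(x) = ∑_{ℓ ≥ 1} x^ℓ / ℓ^β`, for `|x| < 1`. -/
noncomputable def polylog (β x : ℝ) : ℝ :=
  ∑' k : ℕ, x ^ (k + 1) / ((k : ℝ) + 1) ^ β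

/-- The number `(α⁻¹ - 1 + (α⁻¹ + 1) λ²) / (2 λ α⁻¹)`; `l` stands for `λ`. -/
noncomputable def sCenter (l α : ℝ) : ℝ :=
  (α⁻¹ - 1 + (α⁻¹ + 1) * l ^ 2) / (2 * l * α⁻¹)

/-- The number `s*` attached to `λ` (written `l`) and `α`. -/
noncomputable def sStar (l α : ℝ) : ℝ :=
  sCenter l α + Real.sqrt (sCenter l α ^ 2 - 1)

/-- The real Blaschke factor `b_λ(s) = (s - λ) / (1 - λ s)`. -/
noncomputable def blaschkeFactor (l s : ℝ) : ℝ := (s - l) / (1 - l * s)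

/-- The quantity under the square root in the lower bound. -/
noncomputable def radicand (n N : ℕ) (l α β : ℝ) : ℝ :=
  α * (1 - (n : ℝ) / N
    - blaschkeFactor l (sStar l α) ^ (2 * N) * ((n : ℝ) + 1) ^ β
      * polylog β (sStar l α ^ (-2 : ℤ))
      * (sStar l α ^ (2 * (2 - ⌊(N : ℝ) / α⌋)) / (N * (sStar l α ^ 2 - 1) ^ 2)))

end BlaschkeApprox

/-! Let `r = p/q` be a competitor. Some `U`, the inverse of a Blaschke product of degree `m ≤ n`,
makes `r U` holomorphic and bounded on `|z| ≥ 1`, so its Fourier coefficients of index `≥ 1` vanish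
(`exists_fourierCoeff_mul_eq_zero`). As `|U| = 1` on the circle, `F = f U` is unimodular there, `G =
F - r U` has the same L² norm as `f - r`, and `F_k = G_k` for `k ≥ 1`. By the area formula, `∑ k
|F_k|²` is the winding number `N - m ≥ N - n` of `F`
(`hasSum_mul_sq_norm_fourierCoeff_blaschkeQuotient`).

For any cutoff `K`, each term satisfies `k |F_k|² ≤ K |G_k|² + (k - K)⁺ |F_k|²`. The first part sums
to at most `K ‖f - r‖²`. In the second, Cauchy's estimate on `|z| = s` gives `|F_k| ≤ s^(-k)
b_λ(s)^N`, and an arithmetic-geometric series remains (`sub_le_mul_integral_add`). Taking `K =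
⌊N/α⌋` and `s = s*` gives the bound, even with the smaller factor `(s*)⁻²` in place of `(n+1)^β
Li_β((s*)⁻²)` (`radicand_le`).

The proof needs only `1 < s* < 1/λ`. The particular value of `s*` minimizes `b_λ(s) s^(-1/α)` on
this interval: the critical equation is `s + 1/s = 2γ`. -/

namespace BlaschkeApprox

open MeasureTheory Metric Filter Topology

/-! ### Fourier coefficients on the unit circle as contour integrals. -/

/-- The restriction of `g` to the unit circle, as a function of the angle. -/
noncomputable def onCircle (g : ℂ → ℂ) : AddCircle (2 * Real.pi) → ℂ :=
  fun θ => g ((AddCircle.toCircle θ : Circle) : ℂ)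

lemma integral_onCircle (g : ℂ → ℂ) :
    ∫ θ, onCircle g θ ∂AddCircle.haarAddCircle
      = (2 * Real.pi * Complex.I)⁻¹ * ∮ z in C(0, 1), z⁻¹ * g z := by
  rw [AddCircle.integral_haarAddCircle, ← AddCircle.intervalIntegral_preimage (2 * Real.pi) 0,
    zero_add, circleIntegral]
  have : ∀ θ : ℝ, deriv (circleMap 0 1) θ • ((circleMap 0 1 θ)⁻¹ * g (circleMap 0 1 θ))
      = Complex.I * onCircle g (θ : AddCircle (2 * Real.pi)) := by
    intro θ
    have h0 : circleMap 0 1 θ ≠ 0 := circleMap_ne_center one_ne_zero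
    have h1 : ((AddCircle.toCircle (θ : AddCircle (2 * Real.pi)) : Circle) : ℂ)
        = circleMap 0 1 θ := by
      rw [AddCircle.toCircle_apply_mk, div_self Real.two_pi_pos.ne', one_mul, Circle.coe_exp]
      simp [circleMap]
    rw [deriv_circleMap, smul_eq_mul, onCircle, h1]
    field_simp
  simp_rw [this, intervalIntegral.integral_const_mul]
  have hpi : (Real.pi : ℂ) ≠ 0 := by exact_mod_cast Real.pi_ne_zero
  rw [Complex.real_smul]
  push_cast
  field_simp

lemma fourierCoeff_onCircle (g : ℂ → ℂ) (k : ℤ) :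
    fourierCoeff (onCircle g) k
      = (2 * Real.pi * Complex.I)⁻¹ * ∮ z in C(0, 1), z⁻¹ * (z ^ (-k) * g z) := by
  rw [← integral_onCircle]
  unfold fourierCoeff
  congr 1
  ext θ
  rw [fourier_apply, AddCircle.toCircle_zsmul, Circle.coe_zpow]
  rfl

lemma continuous_onCircle {g : ℂ → ℂ} (hg : ContinuousOn g (sphere 0 1)) :
    Continuous (onCircle g) := by
  refine hg.comp_continuous (continuous_subtype_val.comp AddCircle.continuous_toCircle) fun θ => ?_
  rw [mem_sphere_zero_iff_norm]
  exact Circle.norm_coe _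

lemma hasSum_fourierCoeff_mul {g h : ℂ → ℂ} (hg : ContinuousOn g (sphere 0 1))
    (hh : ContinuousOn h (sphere 0 1)) :
    HasSum (fun k : ℤ => conj (fourierCoeff (onCircle g) k) * fourierCoeff (onCircle h) k)
      (∫ θ, conj (onCircle g θ) * onCircle h θ ∂AddCircle.haarAddCircle) := by
  let G : C(AddCircle (2 * Real.pi), ℂ) := ⟨onCircle g, continuous_onCircle hg⟩
  let H : C(AddCircle (2 * Real.pi), ℂ) := ⟨onCircle h, continuous_onCircle hh⟩
  have key := (fourierBasis (T := 2 * Real.pi)).hasSum_inner_mul_inner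
    (ContinuousMap.toLp 2 AddCircle.haarAddCircle ℂ G)
    (ContinuousMap.toLp 2 AddCircle.haarAddCircle ℂ H)
  convert! key using 1
  · funext k
    rw [← inner_conj_symm, ← HilbertBasis.repr_apply_apply, ← HilbertBasis.repr_apply_apply,
      fourierBasis_repr, fourierBasis_repr, fourierCoeff_toLp, fourierCoeff_toLp]
    rfl
  · rw [ContinuousMap.inner_toLp]
    congr 1
    ext θ
    exact mul_comm _ _

lemma hasSum_sq_norm_fourierCoeff {g : ℂ → ℂ} (hg : ContinuousOn g (sphere 0 1)) :
    HasSum (fun k : ℤ => ‖fourierCoeff (onCircle g) k‖ ^ 2)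
      (∫ θ, ‖onCircle g θ‖ ^ 2 ∂AddCircle.haarAddCircle) := by
  have h := hasSum_fourierCoeff_mul hg hg
  simp_rw [Complex.conj_mul'] at h
  have h2 := Complex.hasSum_re h
  convert h2 using 1
  · funext k
    norm_cast
  · rw [← Complex.ofReal_re (∫ θ, ‖onCircle g θ‖ ^ 2 ∂AddCircle.haarAddCircle),
      ← integral_complex_ofReal]
    simp

/-- Integration by parts: the derivative of `z ^ (-k) * g z` has zero integral over the closed
circle. -/
lemma fourierCoeff_mul_deriv {g g' : ℂ → ℂ}
    (hg : ∀ z ∈ sphere (0 : ℂ) 1, HasDerivAt g (g' z) z)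
    (hg' : ContinuousOn g' (sphere 0 1)) (k : ℤ) :
    fourierCoeff (onCircle fun z => z * g' z) k = k * fourierCoeff (onCircle g) k := by
  have hne : ∀ z ∈ sphere (0 : ℂ) 1, z ≠ 0 := fun z hz => ne_zero_of_mem_unit_sphere ⟨z, hz⟩
  have hgc : ContinuousOn g (sphere 0 1) := fun z hz => (hg z hz).continuousAt.continuousWithinAt
  have hz0 : ∀ m : ℤ, ContinuousOn (fun z : ℂ => z ^ m) (sphere 0 1) := fun m =>
    continuousOn_id.zpow₀ m fun z hz => Or.inl (hne z hz)
  have h := circleIntegral.integral_eq_zero_of_hasDerivWithinAt (c := (0 : ℂ)) zero_le_one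
    (f := fun z => z ^ (-k) * g z)
    (f' := fun z => z ^ (-k) * g' z - k * (z ^ (-k - 1) * g z)) (fun z hz => by
      refine HasDerivAt.hasDerivWithinAt ?_
      refine ((hasDerivAt_zpow (-k) z (Or.inl (hne z hz))).mul (hg z hz)).congr_deriv ?_
      push_cast
      ring)
  rw [circleIntegral.integral_sub, circleIntegral.integral_const_mul, sub_eq_zero] at h
  · rw [fourierCoeff_onCircle, fourierCoeff_onCircle]
    have e1 : (∮ z in C((0 : ℂ), 1), z⁻¹ * (z ^ (-k) * (z * g' z)))
        = ∮ z in C((0 : ℂ), 1), z ^ (-k) * g' z :=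
      circleIntegral.integral_congr zero_le_one fun z hz => by
        have := hne z hz
        field_simp
    have e2 : (∮ z in C((0 : ℂ), 1), z⁻¹ * (z ^ (-k) * g z))
        = ∮ z in C((0 : ℂ), 1), z ^ (-k - 1) * g z :=
      circleIntegral.integral_congr zero_le_one fun z hz => by
        have := hne z hz
        simp only [zpow_sub_one₀ this]
        ring
    rw [e1, e2, h]
    ring
  · exact ((hz0 _).mul hg').circleIntegrable zero_le_one
  · exact (continuousOn_const.mul ((hz0 _).mul hgc)).circleIntegrable zero_le_one

/-- The area formula for a unimodular function on the unit circle: `∑ k |g_k|²` is the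
winding number of `g`. -/
lemma hasSum_mul_sq_norm_fourierCoeff {g g' : ℂ → ℂ}
    (hg : ∀ z ∈ sphere (0 : ℂ) 1, HasDerivAt g (g' z) z)
    (hg' : ContinuousOn g' (sphere 0 1)) (h1 : ∀ z ∈ sphere (0 : ℂ) 1, ‖g z‖ = 1) {d : ℝ}
    (hd : (∮ z in C((0 : ℂ), 1), g' z / g z) = 2 * Real.pi * Complex.I * d) :
    HasSum (fun k : ℤ => k * ‖fourierCoeff (onCircle g) k‖ ^ 2) d := by
  have hgc : ContinuousOn g (sphere 0 1) := fun z hz => (hg z hz).continuousAt.continuousWithinAt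
  have h := hasSum_fourierCoeff_mul hgc (continuousOn_id.mul hg')
  have e : (∫ θ, conj (onCircle g θ) * onCircle (fun z => z * g' z) θ ∂AddCircle.haarAddCircle)
      = d := by
    have := integral_onCircle fun z => conj (g z) * (z * g' z)
    refine this.trans ?_
    -- Since `|g| = 1`, `conj g = 1/g`, and the Parseval pairing of `g` with `z g'` becomes the
    -- winding integral.
    have e1 : (∮ z in C((0 : ℂ), 1), z⁻¹ * (conj (g z) * (z * g' z)))
        = ∮ z in C((0 : ℂ), 1), g' z / g z :=
      circleIntegral.integral_congr zero_le_one fun z hz => by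
        have hz0 : z ≠ 0 := ne_zero_of_mem_unit_sphere ⟨z, hz⟩
        have := Complex.inv_eq_conj (h1 z hz)
        simp only [← this]
        field_simp
    rw [e1, hd, inv_mul_cancel_left₀ Complex.two_pi_I_ne_zero]
  have h' : HasSum (fun k : ℤ => conj (fourierCoeff (onCircle g) k)
      * (k * fourierCoeff (onCircle g) k)) (d : ℂ) := by
    rw [← e]
    simp_rw [← fourierCoeff_mul_deriv hg hg']
    exact h
  convert Complex.hasSum_re h' using 1
  · funext k
    rw [mul_left_comm, Complex.conj_mul']
    norm_cast
  · exact (Complex.ofReal_re d).symm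

/-- Cauchy's estimate for the Laurent coefficients on an annulus `1 ≤ |z| ≤ s`. -/
lemma norm_fourierCoeff_onCircle_le {g : ℂ → ℂ} {s C : ℝ} (hs : 1 ≤ s)
    (hg : ∀ z : ℂ, 1 ≤ ‖z‖ → ‖z‖ ≤ s → DifferentiableAt ℂ g z)
    (hC : ∀ z : ℂ, ‖z‖ = s → ‖g z‖ ≤ C) (k : ℤ) :
    ‖fourierCoeff (onCircle g) k‖ ≤ s ^ (-k) * C := by
  have hs0 : 0 < s := zero_lt_one.trans_le hs
  have hd : ∀ z : ℂ, 1 ≤ ‖z‖ → ‖z‖ ≤ s → DifferentiableAt ℂ (fun z => z ^ (-k) * g z) z := by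
    intro z h1 h2
    have hz : z ≠ 0 := norm_pos_iff.1 (zero_lt_one.trans_le h1)
    exact (differentiableAt_zpow.2 (Or.inl hz)).mul (hg z h1 h2)
  have h := Complex.circleIntegral_sub_center_inv_smul_eq_of_differentiable_on_annulus_off_countable
    (c := 0) zero_lt_one hs (f := fun z => z ^ (-k) * g z) Set.countable_empty
    (fun z hz => (hd z (by simpa using hz.2)
      (by simpa using hz.1)).continuousAt.continuousWithinAt)
    (fun z hz => hd z (by simpa using (not_le.1 (fun h => hz.1.2 (by simpa using h))).le)
      (by simpa using (mem_ball.1 hz.1.1).le))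
  simp only [sub_zero, smul_eq_mul] at h
  rw [fourierCoeff_onCircle, ← h, norm_mul]
  have hb := circleIntegral.norm_integral_le_of_norm_le_const (c := (0 : ℂ)) hs0.le
    (f := fun z => z⁻¹ * (z ^ (-k) * g z)) (C := s⁻¹ * (s ^ (-k) * C)) (fun z hz => by
      have hz' : ‖z‖ = s := by simpa using hz
      rw [norm_mul, norm_mul, norm_inv, norm_zpow, hz']
      have := hC z hz'
      gcongr)
  have hn : ‖(2 * Real.pi * Complex.I : ℂ)⁻¹‖ = (2 * Real.pi)⁻¹ := by
    simp [abs_of_pos Real.pi_pos]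
  rw [hn]
  refine (mul_le_mul_of_nonneg_left hb (by positivity)).trans_eq ?_
  have := Real.pi_pos
  field_simp

/-- Let the radius in Cauchy's estimate tend to infinity. -/
lemma fourierCoeff_onCircle_eq_zero {g : ℂ → ℂ} {C : ℝ}
    (hg : ∀ z : ℂ, 1 ≤ ‖z‖ → DifferentiableAt ℂ g z)
    (hC : ∀ z : ℂ, 1 ≤ ‖z‖ → ‖g z‖ ≤ C) {k : ℤ} (hk : 1 ≤ k) :
    fourierCoeff (onCircle g) k = 0 := by
  have hlim : Tendsto (fun s : ℝ => s ^ (-k) * C) atTop (𝓝 0) := by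
    simpa using (tendsto_zpow_atTop_zero (𝕜 := ℝ) (n := -k) (by omega)).mul_const C
  refine norm_le_zero_iff.1 (ge_of_tendsto hlim ?_)
  filter_upwards [eventually_ge_atTop 1] with s hs
  exact norm_fourierCoeff_onCircle_le hs (fun z h _ => hg z h)
    (fun z hz => hC z (hz ▸ hs)) k

/-! ### Blaschke factors of the disk. -/

/-- The Blaschke factor of the disk vanishing at `a`. -/
noncomputable def diskFactor (a z : ℂ) : ℂ := (z - a) / (1 - conj a * z)

/-- The logarithmic derivative of `diskFactor a`. -/
noncomputable def diskFactorLog (a z : ℂ) : ℂ := (z - a)⁻¹ + conj a * (1 - conj a * z)⁻¹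

/-- This identity controls every modulus of `diskFactor` below: on the circle, outside it, and at
radius `s`. -/
lemma norm_sub_sq_eq (a z : ℂ) :
    ‖z - a‖ ^ 2 = ‖1 - conj a * z‖ ^ 2 + (‖z‖ ^ 2 - 1) * (1 - ‖a‖ ^ 2) := by
  simp only [← Complex.normSq_eq_norm_sq, Complex.normSq_apply, Complex.sub_re, Complex.sub_im,
    Complex.mul_re, Complex.mul_im, Complex.conj_re, Complex.conj_im, Complex.one_re,
    Complex.one_im]
  ring

lemma one_sub_le_norm_one_sub_conj_mul (a z : ℂ) : 1 - ‖a‖ * ‖z‖ ≤ ‖1 - conj a * z‖ := by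
  simpa using norm_sub_norm_le (1 : ℂ) (conj a * z)

lemma one_sub_conj_mul_ne_zero {a z : ℂ} (h : ‖a‖ * ‖z‖ < 1) : 1 - conj a * z ≠ 0 :=
  norm_pos_iff.1 ((sub_pos.2 h).trans_le (one_sub_le_norm_one_sub_conj_mul a z))

lemma sub_ne_zero_of_norm_lt {a z : ℂ} (h : ‖a‖ < ‖z‖) : z - a ≠ 0 :=
  sub_ne_zero.2 fun e => h.ne (by rw [e])

lemma norm_diskFactor_eq_one {a z : ℂ} (ha : ‖a‖ < 1) (hz : ‖z‖ = 1) : ‖diskFactor a z‖ = 1 := by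
  have h := norm_sub_sq_eq a z
  rw [hz, one_pow, sub_self, zero_mul, add_zero] at h
  rw [diskFactor, norm_div, (sq_eq_sq₀ (norm_nonneg _) (norm_nonneg _)).1 h, div_self]
  exact norm_ne_zero_iff.2 (one_sub_conj_mul_ne_zero (by rwa [hz, mul_one]))

lemma norm_inv_diskFactor_le_one {a z : ℂ} (ha : ‖a‖ < 1) (hz : 1 ≤ ‖z‖) :
    ‖(diskFactor a z)⁻¹‖ ≤ 1 := by
  rw [diskFactor, inv_div, norm_div]
  refine div_le_one_of_le₀ ?_ (norm_nonneg _)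
  refine (sq_le_sq₀ (norm_nonneg _) (norm_nonneg _)).1 ?_
  rw [norm_sub_sq_eq a z]
  have h1 : 0 ≤ ‖z‖ ^ 2 - 1 := by nlinarith
  have h2 : 0 ≤ 1 - ‖a‖ ^ 2 := by nlinarith [norm_nonneg a]
  nlinarith [mul_nonneg h1 h2]

/-- With `t = |a|` and `s = |z|`, the squared modulus is `1 + (s² - 1)(1 - t²)/|1 - conj a * z|²`.
The denominator is at least `(1 - ts)²`, and `(1 - t²)/(1 - ts)²` increases with `t` (`h1`), so the
extreme case is `a = l`, `z = s`. -/
lemma norm_diskFactor_le {a z : ℂ} {l : ℝ} (ha : ‖a‖ ≤ l) (hl : l < 1) (hz : 1 ≤ ‖z‖)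
    (hlz : l * ‖z‖ < 1) : ‖diskFactor a z‖ ≤ blaschkeFactor l ‖z‖ := by
  set s := ‖z‖
  set t := ‖a‖
  have ht0 : 0 ≤ t := norm_nonneg a
  have hts : t * s ≤ l * s := by gcongr
  have hD := one_sub_le_norm_one_sub_conj_mul a z
  have hpos : 0 < ‖1 - conj a * z‖ := by linarith
  rw [diskFactor, blaschkeFactor, norm_div, div_le_div_iff₀ hpos (by linarith)]
  refine (sq_le_sq₀ (mul_nonneg (norm_nonneg _) (by linarith))
    (mul_nonneg (by linarith) hpos.le)).1 ?_
  rw [mul_pow, mul_pow, norm_sub_sq_eq a z]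
  have h1 : (1 - t ^ 2) * (1 - l * s) ^ 2 ≤ (1 - l ^ 2) * (1 - t * s) ^ 2 := by
    have e : (1 - l ^ 2) * (1 - t * s) ^ 2 - (1 - t ^ 2) * (1 - l * s) ^ 2
        = (l - t) * ((s - l) * (1 - t * s) + (s - t) * (1 - l * s)) := by ring
    have h2 : 0 ≤ (l - t) * ((s - l) * (1 - t * s) + (s - t) * (1 - l * s)) := by
      refine mul_nonneg (by linarith) (add_nonneg ?_ ?_) <;>
        exact mul_nonneg (by linarith) (by linarith)
    linarith
  have h3 : (1 - t * s) ^ 2 ≤ ‖1 - conj a * z‖ ^ 2 := by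
    have : 0 ≤ 1 - t * s := by linarith
    gcongr
  have hl0 : 0 ≤ 1 - l ^ 2 := by nlinarith
  have h4 := h1.trans (mul_le_mul_of_nonneg_left h3 hl0)
  have h5 := mul_le_mul_of_nonneg_left h4 (show 0 ≤ s ^ 2 - 1 by nlinarith)
  linarith [show (s - l) ^ 2 * ‖1 - conj a * z‖ ^ 2 = (1 - l * s) ^ 2 * ‖1 - conj a * z‖ ^ 2
    + (s ^ 2 - 1) * ((1 - l ^ 2) * ‖1 - conj a * z‖ ^ 2) by ring]

lemma differentiableAt_diskFactor {a z : ℂ} (h : ‖a‖ * ‖z‖ < 1) :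
    DifferentiableAt ℂ (diskFactor a) z :=
  DifferentiableAt.div (by fun_prop) (by fun_prop) (one_sub_conj_mul_ne_zero h)

lemma differentiableAt_inv_diskFactor {a z : ℂ} (h : ‖a‖ < ‖z‖) :
    DifferentiableAt ℂ (fun z => (diskFactor a z)⁻¹) z := by
  simp only [diskFactor, inv_div]
  exact DifferentiableAt.div (by fun_prop) (by fun_prop) (sub_ne_zero_of_norm_lt h)

lemma diskFactor_ne_zero {a z : ℂ} (ha : ‖a‖ < 1) (hz : ‖z‖ = 1) : diskFactor a z ≠ 0 :=
  norm_ne_zero_iff.1 (by rw [norm_diskFactor_eq_one ha hz]; exact one_ne_zero)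

lemma logDeriv_diskFactor {a z : ℂ} (ha : ‖a‖ < 1) (hz : ‖z‖ = 1) :
    logDeriv (diskFactor a) z = diskFactorLog a z := by
  have h1 : z - a ≠ 0 := sub_ne_zero_of_norm_lt (by rwa [hz])
  have h2 : 1 - conj a * z ≠ 0 := one_sub_conj_mul_ne_zero (by rwa [hz, mul_one])
  have := logDeriv_div (f := fun z => z - a) (g := fun z => 1 - conj a * z) z h1 h2
    (by fun_prop) (by fun_prop)
  refine this.trans ?_
  have d1 : deriv (fun z => z - a) z = 1 := by simp
  have d2 : deriv (fun z => 1 - conj a * z) z = -conj a := by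
    simp
  rw [logDeriv_apply, logDeriv_apply, d1, d2, diskFactorLog]
  ring

lemma logDeriv_inv_diskFactor {a z : ℂ} (ha : ‖a‖ < 1) (hz : ‖z‖ = 1) :
    logDeriv (fun z => (diskFactor a z)⁻¹) z = -diskFactorLog a z := by
  have h := logDeriv_fun_zpow (f := diskFactor a) (x := z)
    (differentiableAt_diskFactor (by rwa [hz, mul_one])) (-1)
  simpa [logDeriv_diskFactor ha hz] using h

lemma continuousOn_diskFactorLog {a : ℂ} (ha : ‖a‖ < 1) :
    ContinuousOn (diskFactorLog a) (sphere 0 1) := by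
  refine ContinuousOn.add (ContinuousOn.inv₀ (by fun_prop) fun z hz => ?_)
    (continuousOn_const.mul (ContinuousOn.inv₀ (by fun_prop) fun z hz => ?_))
  · exact sub_ne_zero_of_norm_lt (by rwa [mem_sphere_zero_iff_norm.1 hz])
  · exact one_sub_conj_mul_ne_zero (by rwa [mem_sphere_zero_iff_norm.1 hz, mul_one])

/-- Each factor winds once: the only pole inside the disk is `a`, with residue 1. -/
lemma circleIntegral_diskFactorLog {a : ℂ} (ha : ‖a‖ < 1) :
    (∮ z in C((0 : ℂ), 1), diskFactorLog a z) = 2 * Real.pi * Complex.I := by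
  have h1 : ∀ z : ℂ, ‖z‖ ≤ 1 → 1 - conj a * z ≠ 0 := fun z hz =>
    one_sub_conj_mul_ne_zero ((mul_le_of_le_one_right (norm_nonneg a) hz).trans_lt ha)
  have hc : ContinuousOn (fun z => conj a * (1 - conj a * z)⁻¹) (closedBall 0 1) :=
    continuousOn_const.mul (ContinuousOn.inv₀ (by fun_prop) fun z hz =>
      h1 z (mem_closedBall_zero_iff.1 hz))
  have h2 : (∮ z in C((0 : ℂ), 1), conj a * (1 - conj a * z)⁻¹) = 0 := by
    refine Complex.circleIntegral_eq_zero_of_differentiable_on_off_countable zero_le_one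
      Set.countable_empty hc fun z hz => ?_
    have hd : DifferentiableAt ℂ (fun z => 1 - conj a * z) z := by fun_prop
    exact (hd.inv (h1 z (mem_ball_zero_iff.1 hz.1).le)).const_mul _
  simp only [diskFactorLog]
  rw [circleIntegral.integral_add, h2, add_zero, circleIntegral.integral_sub_inv_of_mem_ball]
  · simpa using ha
  · refine (ContinuousOn.inv₀ (by fun_prop) fun z hz => ?_).circleIntegrable zero_le_one
    exact sub_ne_zero_of_norm_lt (by rwa [mem_sphere_zero_iff_norm.1 hz])
  · exact (hc.mono sphere_subset_closedBall).circleIntegrable zero_le_one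

/-! ### Quotients of Blaschke products and their winding number. -/

/-- The quotient of two finite Blaschke products, multiplied by a constant. -/
noncomputable def blaschkeQuotient {N m : ℕ} (c : ℂ) (ζ : Fin N → ℂ) (w : Fin m → ℂ) (z : ℂ) : ℂ :=
  c * (∏ i, diskFactor (ζ i) z) * ∏ j, (diskFactor (w j) z)⁻¹

section

variable {N m : ℕ} {c : ℂ} {ζ : Fin N → ℂ} {w : Fin m → ℂ}

lemma norm_blaschkeQuotient_eq_one (hc : ‖c‖ = 1) (hζ : ∀ i, ‖ζ i‖ < 1) (hw : ∀ j, ‖w j‖ < 1)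
    {z : ℂ} (hz : ‖z‖ = 1) : ‖blaschkeQuotient c ζ w z‖ = 1 := by
  simp [blaschkeQuotient, norm_prod, hc, norm_diskFactor_eq_one (hζ _) hz,
    norm_diskFactor_eq_one (hw _) hz]

lemma norm_blaschkeQuotient_le {l : ℝ} (hc : ‖c‖ = 1) (hζ : ∀ i, ‖ζ i‖ ≤ l) (hl : l < 1)
    (hw : ∀ j, ‖w j‖ < 1) {z : ℂ} (hz : 1 ≤ ‖z‖) (hlz : l * ‖z‖ < 1) :
    ‖blaschkeQuotient c ζ w z‖ ≤ blaschkeFactor l ‖z‖ ^ N := by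
  rw [blaschkeQuotient, norm_mul, norm_mul, hc, one_mul, norm_prod, norm_prod]
  refine (mul_le_of_le_one_right (Finset.prod_nonneg fun _ _ => norm_nonneg _)
    (Finset.prod_le_one (fun _ _ => norm_nonneg _)
      fun j _ => norm_inv_diskFactor_le_one (hw j) hz)).trans ?_
  refine (Finset.prod_le_prod (fun _ _ => norm_nonneg _)
    fun i _ => norm_diskFactor_le (hζ i) hl hz hlz).trans_eq ?_
  simp

lemma differentiableAt_blaschkeQuotient (hw : ∀ j, ‖w j‖ < 1) {z : ℂ} (hz : 1 ≤ ‖z‖)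
    (hζ : ∀ i, ‖ζ i‖ * ‖z‖ < 1) : DifferentiableAt ℂ (blaschkeQuotient c ζ w) z :=
  ((DifferentiableAt.fun_finsetProd fun i _ => differentiableAt_diskFactor (hζ i)).const_mul
    c).mul (DifferentiableAt.fun_finsetProd fun j _ =>
      differentiableAt_inv_diskFactor ((hw j).trans_le hz))

lemma hasDerivAt_blaschkeQuotient (hc : ‖c‖ = 1) (hζ : ∀ i, ‖ζ i‖ < 1) (hw : ∀ j, ‖w j‖ < 1)
    {z : ℂ} (hz : ‖z‖ = 1) :
    HasDerivAt (blaschkeQuotient c ζ w) (blaschkeQuotient c ζ w z *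
      (∑ i, diskFactorLog (ζ i) z - ∑ j, diskFactorLog (w j) z)) z := by
  have hd : DifferentiableAt ℂ (blaschkeQuotient c ζ w) z :=
    differentiableAt_blaschkeQuotient hw hz.ge fun i => by rw [hz, mul_one]; exact hζ i
  have hc0 : c ≠ 0 := norm_ne_zero_iff.1 (by rw [hc]; exact one_ne_zero)
  have hF : blaschkeQuotient c ζ w z ≠ 0 :=
    norm_ne_zero_iff.1 (by rw [norm_blaschkeQuotient_eq_one hc hζ hw hz]; exact one_ne_zero)
  have hd1 : ∀ i, DifferentiableAt ℂ (diskFactor (ζ i)) z := fun i =>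
    differentiableAt_diskFactor (by rw [hz, mul_one]; exact hζ i)
  have hd2 : ∀ j, DifferentiableAt ℂ (fun z => (diskFactor (w j) z)⁻¹) z := fun j =>
    differentiableAt_inv_diskFactor (by rw [hz]; exact hw j)
  have hn1 : ∀ i, diskFactor (ζ i) z ≠ 0 := fun i => diskFactor_ne_zero (hζ i) hz
  have hn2 : ∀ j, (diskFactor (w j) z)⁻¹ ≠ 0 := fun j =>
    inv_ne_zero (diskFactor_ne_zero (hw j) hz)
  have hlog : logDeriv (blaschkeQuotient c ζ w) z
      = ∑ i, diskFactorLog (ζ i) z - ∑ j, diskFactorLog (w j) z := by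
    have e1 := logDeriv_mul (f := fun z => c * ∏ i, diskFactor (ζ i) z)
      (g := fun z => ∏ j, (diskFactor (w j) z)⁻¹) z
      (mul_ne_zero hc0 (Finset.prod_ne_zero_iff.2 fun i _ => hn1 i))
      (Finset.prod_ne_zero_iff.2 fun j _ => hn2 j)
      ((DifferentiableAt.fun_finsetProd fun i _ => hd1 i).const_mul c)
      (DifferentiableAt.fun_finsetProd fun j _ => hd2 j)
    refine e1.trans ?_
    rw [logDeriv_const_mul z c hc0, logDeriv_prod (fun i _ => hn1 i) (fun i _ => hd1 i),
      logDeriv_prod (fun j _ => hn2 j) (fun j _ => hd2 j)]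
    simp only [logDeriv_diskFactor (hζ _) hz, logDeriv_inv_diskFactor (hw _) hz,
      Finset.sum_neg_distrib, sub_eq_add_neg]
  rw [← hlog, logDeriv_apply, mul_div_cancel₀ _ hF]
  exact hd.hasDerivAt

lemma hasSum_mul_sq_norm_fourierCoeff_blaschkeQuotient (hc : ‖c‖ = 1) (hζ : ∀ i, ‖ζ i‖ < 1)
    (hw : ∀ j, ‖w j‖ < 1) :
    HasSum (fun k : ℤ => k * ‖fourierCoeff (onCircle (blaschkeQuotient c ζ w)) k‖ ^ 2)
      ((N : ℝ) - m) := by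
  have hs : ∀ z ∈ sphere (0 : ℂ) 1, ‖z‖ = 1 := fun z hz => mem_sphere_zero_iff_norm.1 hz
  have c1 : ContinuousOn (fun z => ∑ i, diskFactorLog (ζ i) z) (sphere 0 1) :=
    continuousOn_finsetSum _ fun i _ => continuousOn_diskFactorLog (hζ i)
  have c2 : ContinuousOn (fun z => ∑ j, diskFactorLog (w j) z) (sphere 0 1) :=
    continuousOn_finsetSum _ fun j _ => continuousOn_diskFactorLog (hw j)
  refine hasSum_mul_sq_norm_fourierCoeff
    (fun z hz => hasDerivAt_blaschkeQuotient hc hζ hw (hs z hz)) ?_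
    (fun z hz => norm_blaschkeQuotient_eq_one hc hζ hw (hs z hz)) ?_
  · exact ContinuousOn.mul (fun z hz => (hasDerivAt_blaschkeQuotient hc hζ hw
      (hs z hz)).continuousAt.continuousWithinAt) (c1.sub c2)
  · have e : (∮ z in C((0 : ℂ), 1), blaschkeQuotient c ζ w z *
        (∑ i, diskFactorLog (ζ i) z - ∑ j, diskFactorLog (w j) z) / blaschkeQuotient c ζ w z)
        = ∮ z in C((0 : ℂ), 1), (∑ i, diskFactorLog (ζ i) z - ∑ j, diskFactorLog (w j) z) := by
      refine circleIntegral.integral_congr zero_le_one fun z hz => mul_div_cancel_left₀ _ ?_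
      exact norm_ne_zero_iff.1
        (by rw [norm_blaschkeQuotient_eq_one hc hζ hw (hs z hz)]; exact one_ne_zero)
    rw [e, circleIntegral.integral_sub (c1.circleIntegrable zero_le_one)
      (c2.circleIntegrable zero_le_one), circleIntegral.integral_fun_sum,
      circleIntegral.integral_fun_sum]
    · simp only [circleIntegral_diskFactorLog (hζ _), circleIntegral_diskFactorLog (hw _),
        Finset.sum_const, Finset.card_univ, Fintype.card_fin, nsmul_eq_mul]
      push_cast
      ring
    · exact fun j _ => (continuousOn_diskFactorLog (hw j)).circleIntegrable zero_le_one
    · exact fun i _ => (continuousOn_diskFactorLog (hζ i)).circleIntegrable zero_le_one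

end

/-! ### Removing the exterior poles of a rational function. -/

/-- A polynomial with prescribed roots off the unit circle becomes, after multiplication by
the inverse of a suitable finite Blaschke product, the reciprocal of a polynomial with all its
roots in the disk. -/
lemma exists_prod_inv_diskFactor_eq (n : ℕ) (S : Multiset ℂ) (hS : ∀ a ∈ S, ‖a‖ ≠ 1)
    (hcard : S.card ≤ n) :
    ∃ m ≤ n, ∃ (w : Fin m → ℂ) (b : Fin n → ℂ) (κ : ℂ), (∀ j, ‖w j‖ < 1) ∧ (∀ i, ‖b i‖ < 1) ∧
      ∀ z : ℂ, ‖z‖ = 1 →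
        ∏ j, (diskFactor (w j) z)⁻¹ = κ * (S.map fun a => z - a).prod / ∏ i, (z - b i) := by
  induction n generalizing S with
  | zero =>
    obtain rfl : S = 0 := Multiset.card_eq_zero.1 (Nat.le_zero.1 hcard)
    exact ⟨0, le_rfl, Fin.elim0, Fin.elim0, 1, fun j => j.elim0, fun j => j.elim0, by simp⟩
  | succ n ih =>
    induction S using Multiset.induction_on with
    | empty =>
      -- Missing roots are padded by factors `1/z`, so that the denominator has degree exactly `n`;
      -- this gives boundedness at infinity when `deg p ≤ n`.
      exact ⟨n + 1, le_rfl, 0, 0, 1, by simp, by simp, fun z _ => by simp [diskFactor]⟩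
    | cons a S _ =>
      obtain ⟨m, hm, w, b, κ, hw, hb, h⟩ := ih S (fun x hx => hS x (Multiset.mem_cons_of_mem hx))
        (by simpa using hcard)
      rcases lt_or_gt_of_ne (hS a (Multiset.mem_cons_self a S)) with ha | ha
      -- A root inside the disk needs no Blaschke factor; it simply stays in the denominator.
      · refine ⟨m, by omega, w, Fin.cons a b, κ, hw, Fin.cases (by simpa) (by simpa), ?_⟩
        intro z hz
        have h1 : z - a ≠ 0 := sub_ne_zero_of_norm_lt (by rwa [hz])
        rw [h z hz, Multiset.map_cons, Multiset.prod_cons, Fin.prod_univ_succ]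
        simp only [Fin.cons_zero, Fin.cons_succ]
        rw [mul_left_comm, mul_div_mul_left _ _ h1]
      · have ha0 : a ≠ 0 := norm_pos_iff.1 (zero_lt_one.trans ha)
        have hA : ‖(conj a)⁻¹‖ < 1 := by
          rw [norm_inv, RCLike.norm_conj]
          exact inv_lt_one_of_one_lt₀ ha
        -- A root outside is reflected to `1 / conj a`: the inverse factor there is `(-1/a)(z -
        -- a)/(z - 1/conj a)`.
        refine ⟨m + 1, by omega, Fin.cons (conj a)⁻¹ w, Fin.cons (conj a)⁻¹ b, -κ / a,
          Fin.cases (by simpa using hA) (by simpa), Fin.cases (by simpa using hA) (by simpa), ?_⟩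
        intro z hz
        rw [Fin.prod_univ_succ, Fin.prod_univ_succ, Multiset.map_cons, Multiset.prod_cons]
        simp only [Fin.cons_zero, Fin.cons_succ]
        rw [h z hz, diskFactor, inv_div, map_inv₀, Complex.conj_conj, div_mul_div_comm]
        congr 1
        field_simp
        ring

lemma exists_norm_eval_le (p : Polynomial ℂ) {n : ℕ} (hp : p.natDegree ≤ n) :
    ∃ C : ℝ, ∀ z : ℂ, 1 ≤ ‖z‖ → ‖p.eval z‖ ≤ C * ‖z‖ ^ n := by
  refine ⟨∑ i ∈ Finset.range (n + 1), ‖p.coeff i‖, fun z hz => ?_⟩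
  rw [Polynomial.eval_eq_sum_range' (Nat.lt_succ_of_le hp), Finset.sum_mul]
  refine norm_sum_le_of_le _ fun i hi => ?_
  rw [norm_mul, norm_pow]
  have : i ≤ n := Nat.lt_succ_iff.1 (Finset.mem_range.1 hi)
  gcongr

/-- On the circle the product is a constant times `p / ∏ (z - b i)`, with `n` roots `b i` in the
disk and `deg p ≤ n`; this is holomorphic and bounded on `|z| ≥ 1`. -/
lemma exists_fourierCoeff_mul_eq_zero {n : ℕ} {r : ℂ → ℂ} (hr : r ∈ ratFun n n) :
    ContinuousOn r (sphere 0 1) ∧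
    ∃ m ≤ n, ∃ w : Fin m → ℂ, (∀ j, ‖w j‖ < 1) ∧ ∀ k : ℤ, 1 ≤ k →
      fourierCoeff (onCircle fun z => r z * ∏ j, (diskFactor (w j) z)⁻¹) k = 0 := by
  obtain ⟨p, q, hp, hq, hq0, rfl⟩ := hr
  have hqne : q ≠ 0 := by
    rintro rfl
    exact hq0 1 norm_one (by simp)
  refine ⟨ContinuousOn.div p.continuousOn q.continuousOn
    fun z hz => hq0 z (mem_sphere_zero_iff_norm.1 hz), ?_⟩
  obtain ⟨m, hm, w, b, κ, hw, hb, h⟩ := exists_prod_inv_diskFactor_eq n q.roots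
    (fun a ha h1 => hq0 a h1 ((Polynomial.mem_roots hqne).1 ha))
    ((Polynomial.card_roots' q).trans hq)
  refine ⟨m, hm, w, hw, fun k hk => ?_⟩
  have hfac : ∀ z, q.eval z = q.leadingCoeff * (q.roots.map fun a => z - a).prod := by
    intro z
    conv_lhs => rw [(IsAlgClosed.splits q).eq_prod_roots]
    simp [Polynomial.eval_multiset_prod, Multiset.map_map]
  set g : ℂ → ℂ := fun z => κ / q.leadingCoeff * p.eval z / ∏ i, (z - b i)
  have hg : (onCircle fun z => p.eval z / q.eval z * ∏ j, (diskFactor (w j) z)⁻¹)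
      = onCircle g := by
    funext θ
    have hz : ‖((AddCircle.toCircle θ : Circle) : ℂ)‖ = 1 := Circle.norm_coe _
    have h0 := hq0 _ hz
    simp only [onCircle, g, h _ hz]
    rw [hfac] at h0 ⊢
    have h2 := right_ne_zero_of_mul h0
    have h3 := left_ne_zero_of_mul h0
    rw [div_mul_div_comm]
    rw [div_mul_eq_mul_div, div_div]
    rw [← mul_div_mul_right (κ * _) (q.leadingCoeff * _) h2]
    congr 1 <;> ring
  rw [hg]
  obtain ⟨C, hC⟩ := exists_norm_eval_le p hp
  have hbz : ∀ z : ℂ, 1 ≤ ‖z‖ → ∀ i, (1 - ‖b i‖) * ‖z‖ ≤ ‖z - b i‖ := fun z hz i => by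
    have := norm_sub_norm_le z (b i)
    nlinarith [norm_nonneg (b i)]
  have hpos : 0 < ∏ i, (1 - ‖b i‖) := Finset.prod_pos fun i _ => sub_pos.2 (hb i)
  refine fourierCoeff_onCircle_eq_zero (C := ‖κ / q.leadingCoeff‖ * C / ∏ i, (1 - ‖b i‖))
    (fun z hz => ?_) (fun z hz => ?_) hk
  · refine DifferentiableAt.div (by fun_prop) (by fun_prop) (Finset.prod_ne_zero_iff.2 ?_)
    exact fun i _ => sub_ne_zero_of_norm_lt ((hb i).trans_le hz)
  · have hz0 : 0 < ‖z‖ := zero_lt_one.trans_le hz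
    have hprod : (∏ i, (1 - ‖b i‖)) * ‖z‖ ^ n ≤ ‖∏ i, (z - b i)‖ := by
      rw [norm_prod]
      refine le_trans (le_of_eq ?_) (Finset.prod_le_prod
        (fun i _ => mul_nonneg (sub_pos.2 (hb i)).le hz0.le) fun i _ => hbz z hz i)
      simp [Finset.prod_mul_distrib]
    have hP : 0 < (∏ i, (1 - ‖b i‖)) * ‖z‖ ^ n := by positivity
    simp only [g]
    rw [norm_div, norm_mul]
    calc _ ≤ ‖κ / q.leadingCoeff‖ * (C * ‖z‖ ^ n) / ((∏ i, (1 - ‖b i‖)) * ‖z‖ ^ n) := by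
            have := hC z hz
            have h0 : 0 ≤ C * ‖z‖ ^ n := (norm_nonneg _).trans this
            gcongr
      _ = _ := by field_simp

/-! ### The constants `s*` and `Li_β`. -/

lemma one_lt_sCenter {l α : ℝ} (hl0 : 0 < l) (hl1 : l < 1) (hα0 : 0 < α)
    (hα1 : α < (1 - l) / (1 + l)) : 1 < sCenter l α := by
  rw [lt_div_iff₀ (by linarith)] at hα1
  have e : sCenter l α = ((1 - α) + (1 + α) * l ^ 2) / (2 * l) := by
    rw [sCenter]; field_simp
  rw [e, lt_div_iff₀ (by linarith)]
  -- The goal amounts to `α (1 - l²) < (1 - l)²`, which is the hypothesis times `1 - l`.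
  nlinarith [mul_pos (sub_pos.2 hα1) (sub_pos.2 hl1)]

lemma one_lt_sStar {l α : ℝ} (hl0 : 0 < l) (hl1 : l < 1) (hα0 : 0 < α)
    (hα1 : α < (1 - l) / (1 + l)) : 1 < sStar l α :=
  (one_lt_sCenter hl0 hl1 hα0 hα1).trans_le (le_add_of_nonneg_right (Real.sqrt_nonneg _))

lemma sStar_lt_inv {l α : ℝ} (hl0 : 0 < l) (hl1 : l < 1) (hα0 : 0 < α) :
    sStar l α < 1 / l := by
  have e : sCenter l α = ((1 - α) + (1 + α) * l ^ 2) / (2 * l) := by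
    rw [sCenter]; field_simp
  have hl2 : l ^ 2 < 1 := by nlinarith
  have e1 : 1 / l - sCenter l α = ((1 + α) * (1 - l ^ 2)) / (2 * l) := by
    rw [e]; field_simp; ring
  have hpos : 0 < 1 / l - sCenter l α := by
    rw [e1]
    have : 0 < 1 - l ^ 2 := by linarith
    positivity
  have h : Real.sqrt (sCenter l α ^ 2 - 1) < 1 / l - sCenter l α := by
    rw [Real.sqrt_lt' hpos]
    have e2 : (1 / l - sCenter l α) ^ 2 - (sCenter l α ^ 2 - 1) = α * (1 - l ^ 2) / l ^ 2 := by
      rw [e]; field_simp; ring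
    have : 0 < α * (1 - l ^ 2) / l ^ 2 := by
      have : 0 < 1 - l ^ 2 := by linarith
      positivity
    linarith
  rw [sStar]
  linarith

/-- The first term of the series is already `x`, and the power of `n + 1` is at least 1. -/
lemma le_rpow_mul_polylog {β x : ℝ} (hβ : 0 ≤ β) (hx0 : 0 ≤ x) (hx1 : x < 1) (n : ℕ) :
    x ≤ ((n : ℝ) + 1) ^ β * polylog β x := by
  have hterm : ∀ k : ℕ, x ^ (k + 1) / ((k : ℝ) + 1) ^ β ≤ x ^ k := fun k => by
    have h1 : 1 ≤ ((k : ℝ) + 1) ^ β :=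
      Real.one_le_rpow (le_add_of_nonneg_left k.cast_nonneg) hβ
    exact (div_le_self (by positivity) h1).trans
      (pow_le_pow_of_le_one hx0 hx1.le k.le_succ)
  have hsum : Summable fun k : ℕ => x ^ (k + 1) / ((k : ℝ) + 1) ^ β :=
    Summable.of_nonneg_of_le (fun k => by positivity) hterm
      (summable_geometric_of_lt_one hx0 hx1)
  have h0 : x ≤ polylog β x := by
    simpa [polylog] using hsum.le_tsum 0 (fun k _ => by positivity)
  have h1 : 1 ≤ ((n : ℝ) + 1) ^ β :=
    Real.one_le_rpow (le_add_of_nonneg_left n.cast_nonneg) hβ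
  exact h0.trans (le_mul_of_one_le_left (hx0.trans h0) h1)

/-! ### The L² estimate. -/

lemma normL2_eq {g : ℂ → ℂ} (hg : ContinuousOn g (sphere 0 1)) :
    normL2 g = ENNReal.ofReal
      (Real.sqrt (∫ θ, ‖onCircle g θ‖ ^ 2 ∂AddCircle.haarAddCircle)) := by
  have hm : MemLp (onCircle g) 2 AddCircle.haarAddCircle :=
    (continuous_onCircle hg).memLp_of_hasCompactSupport
      (HasCompactSupport.of_compactSpace _)
  have h := hm.eLpNorm_eq_integral_rpow_norm two_ne_zero ENNReal.ofNat_ne_top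
  refine h.trans ?_
  rw [Real.sqrt_eq_rpow]
  simp

/-- The tail majorant, extended by zero to all of `ℤ` so that it can be compared termwise with
Fourier series. -/
lemma exists_hasSum_int_arith_geom {A x : ℝ} (hA : 0 ≤ A) (hx0 : 0 ≤ x) (hx1 : x < 1) (K : ℕ) :
    ∃ t : ℤ → ℝ, HasSum t (A * (x ^ K * (x / (1 - x) ^ 2))) ∧ (∀ k, 0 ≤ t k) ∧
      ∀ j : ℕ, t ((j : ℤ) + K) = A * (x ^ K * (j * x ^ j)) := by
  have hinj : Function.Injective (fun j : ℕ => (j : ℤ) + K) := fun a b h => by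
    simpa using h
  refine ⟨Function.extend (fun j : ℕ => (j : ℤ) + K) (fun j : ℕ => A * (x ^ K * (j * x ^ j))) 0,
    ?_, fun k => ?_, fun j => hinj.extend_apply _ _ j⟩
  · rw [hasSum_extend_zero hinj]
    have h : HasSum (fun j : ℕ => j * x ^ j) (x / (1 - x) ^ 2) :=
      hasSum_coe_mul_geometric_of_norm_lt_one (by rwa [Real.norm_of_nonneg hx0])
    exact (h.mul_left (x ^ K)).mul_left A
  · by_cases hk : ∃ j : ℕ, (j : ℤ) + K = k
    · obtain ⟨j, rfl⟩ := hk
      rw [hinj.extend_apply]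
      positivity
    · rw [Function.extend_apply' _ _ _ hk]
      exact le_rfl

/-- The distance from a finite Blaschke product of degree `N` to a rational function `r` of degree
at most `n` controls `N - n`, up to a tail of the Laurent expansion. -/
lemma sub_le_mul_integral_add {n N : ℕ} {f r : ℂ → ℂ} {c : ℂ} {ζ : Fin N → ℂ} {l s : ℝ}
    (hc : ‖c‖ = 1) (hl : l < 1) (hζ : ∀ i, ‖ζ i‖ ≤ l)
    (hf : ∀ z : ℂ, ‖z‖ = 1 → f z = c * ∏ i, diskFactor (ζ i) z)
    (hr : r ∈ ratFun n n) (hs : 1 < s) (hls : l * s < 1) (K : ℕ) :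
    (N : ℝ) - n ≤
      K * ∫ θ, ‖onCircle (fun z => f z - r z) θ‖ ^ 2 ∂AddCircle.haarAddCircle
        + blaschkeFactor l s ^ (2 * N) *
          ((s ^ 2)⁻¹ ^ K * ((s ^ 2)⁻¹ / (1 - (s ^ 2)⁻¹) ^ 2)) := by
  obtain ⟨hrc, m, hm, w, hw, hcoef⟩ := exists_fourierCoeff_mul_eq_zero hr
  have hζ1 : ∀ i, ‖ζ i‖ < 1 := fun i => (hζ i).trans_lt hl
  have hs0 : 0 < s := zero_lt_one.trans hs
  set F := blaschkeQuotient c ζ w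
  set U : ℂ → ℂ := fun z => ∏ j, (diskFactor (w j) z)⁻¹
  set B := blaschkeFactor l s
  set x := (s ^ 2)⁻¹
  have hx0 : 0 < x := by positivity
  have hx1 : x < 1 := inv_lt_one_of_one_lt₀ (by nlinarith)
  have hUc : ContinuousOn U (sphere 0 1) := fun z hz =>
    (DifferentiableAt.fun_finsetProd fun j _ => differentiableAt_inv_diskFactor
      (by rw [mem_sphere_zero_iff_norm.1 hz]; exact hw j)).continuousAt.continuousWithinAt
  have hFc : ContinuousOn F (sphere 0 1) := fun z hz =>
    (hasDerivAt_blaschkeQuotient hc hζ1 hw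
      (mem_sphere_zero_iff_norm.1 hz)).continuousAt.continuousWithinAt
  have hFeq : ∀ z : ℂ, ‖z‖ = 1 → F z = f z * U z := fun z hz => by rw [hf z hz]; rfl
  have hGc : ContinuousOn (fun z => F z - r z * U z) (sphere 0 1) := hFc.sub (hrc.mul hUc)
  have hGcoef : ∀ k : ℤ, 1 ≤ k → fourierCoeff (onCircle fun z => F z - r z * U z) k
      = fourierCoeff (onCircle F) k := by
    intro k hk
    have h1 : (onCircle F) = (onCircle fun z => F z - r z * U z) + onCircle fun z => r z * U z := by
      funext θ
      simp [onCircle]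
    have hi : ∀ {g : ℂ → ℂ}, ContinuousOn g (sphere 0 1) →
        Integrable (onCircle g) AddCircle.haarAddCircle := fun hg =>
      (continuous_onCircle hg).integrable_of_hasCompactSupport
        (HasCompactSupport.of_compactSpace _)
    rw [h1, fourierCoeff.add (hi hGc) (hi (g := fun z => r z * U z) (hrc.mul hUc)), Pi.add_apply, hcoef k hk, add_zero]
  have hGnorm : (∫ θ, ‖onCircle (fun z => F z - r z * U z) θ‖ ^ 2 ∂AddCircle.haarAddCircle)
      = ∫ θ, ‖onCircle (fun z => f z - r z) θ‖ ^ 2 ∂AddCircle.haarAddCircle := by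
    congr 1
    funext θ
    have hz : ‖((AddCircle.toCircle θ : Circle) : ℂ)‖ = 1 := Circle.norm_coe _
    have hU : ‖U ((AddCircle.toCircle θ : Circle) : ℂ)‖ = 1 := by
      simp [U, norm_prod, norm_diskFactor_eq_one (hw _) hz]
    simp only [onCircle]
    rw [hFeq _ hz, ← sub_mul, norm_mul, hU, mul_one]
  have hbound : ∀ k : ℤ, ‖fourierCoeff (onCircle F) k‖ ≤ s ^ (-k) * B ^ N := fun k => by
    refine norm_fourierCoeff_onCircle_le hs.le (fun z h1 h2 => ?_) (fun z hz => ?_) k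
    · refine differentiableAt_blaschkeQuotient hw h1 fun i => ?_
      have : ‖ζ i‖ * ‖z‖ ≤ l * s :=
        mul_le_mul (hζ i) h2 (norm_nonneg z) ((norm_nonneg _).trans (hζ i))
      linarith
    · have := norm_blaschkeQuotient_le (w := w) hc hζ hl hw (z := z) (by rw [hz]; exact hs.le)
        (by rwa [hz])
      rwa [hz] at this
  have hsumF := hasSum_mul_sq_norm_fourierCoeff_blaschkeQuotient hc hζ1 hw
  have hsumG := (hasSum_sq_norm_fourierCoeff hGc).mul_left (K : ℝ)
  rw [hGnorm] at hsumG
  have hB : 0 ≤ B ^ (2 * N) := (even_two_mul N).pow_nonneg B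
  obtain ⟨tail, hsumT, htail0, htail⟩ := exists_hasSum_int_arith_geom hB hx0.le hx1 K
  refine le_trans (sub_le_sub_left (by exact_mod_cast hm) _)
    (hasSum_le (fun k => ?_) hsumF (hsumG.add hsumT))
  -- Three ranges: for `k ≤ 0` the left side is nonpositive; for `1 ≤ k ≤ K` the weight `k` is at
  -- most `K`; for `k = K + j` the weight splits, and only its `j` part goes to the tail.
  rcases le_or_gt k 0 with hk | hk
  · have h1 : (k : ℝ) ≤ 0 := by exact_mod_cast hk
    have h2 := htail0 k
    have h3 : (k : ℝ) * ‖fourierCoeff (onCircle F) k‖ ^ 2 ≤ 0 :=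
      mul_nonpos_of_nonpos_of_nonneg h1 (by positivity)
    exact h3.trans (by positivity)
  · rw [hGcoef k hk]
    rcases le_or_gt k K with hkK | hkK
    · have h1 : (k : ℝ) ≤ K := by exact_mod_cast hkK
      exact (mul_le_mul_of_nonneg_right h1 (by positivity)).trans
        (le_add_of_nonneg_right (htail0 k))
    · obtain ⟨j, rfl⟩ : ∃ j : ℕ, k = j + K := ⟨(k - K).toNat, by omega⟩
      rw [htail]
      have h1 : ‖fourierCoeff (onCircle F) ((j : ℤ) + K)‖ ^ 2 ≤ B ^ (2 * N) * (x ^ K * x ^ j) := by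
        refine (pow_le_pow_left₀ (norm_nonneg _) (hbound _) 2).trans_eq ?_
        rw [mul_pow, ← pow_mul, mul_comm N 2, mul_comm, ← pow_add]
        congr 1
        simp only [x]
        rw [zpow_neg, ← Nat.cast_add, zpow_natCast, inv_pow, inv_pow, ← pow_mul, ← pow_mul]
        congr 2
        ring
      have h2 := mul_le_mul_of_nonneg_left h1 (Nat.cast_nonneg (α := ℝ) j)
      push_cast
      linarith

lemma radicand_le {n N : ℕ} (hN : 0 < N) {l α β I : ℝ} (hl0 : 0 < l) (hl1 : l < 1)
    (hα0 : 0 < α) (hα1 : α < (1 - l) / (1 + l)) (hβ : 0 ≤ β) (hI : 0 ≤ I)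
    (h : (N : ℝ) - n ≤ ⌊(N : ℝ) / α⌋₊ * I + blaschkeFactor l (sStar l α) ^ (2 * N) *
      ((sStar l α ^ 2)⁻¹ ^ ⌊(N : ℝ) / α⌋₊ *
        ((sStar l α ^ 2)⁻¹ / (1 - (sStar l α ^ 2)⁻¹) ^ 2))) :
    radicand n N l α β ≤ I := by
  have hs := one_lt_sStar hl0 hl1 hα0 hα1
  have hN' : (0 : ℝ) < N := by exact_mod_cast hN
  rw [radicand]
  rw [← Int.natCast_floor_eq_floor (div_nonneg hN'.le hα0.le)]
  have hK := Nat.floor_le (div_nonneg hN'.le hα0.le)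
  set K := ⌊(N : ℝ) / α⌋₊
  set s := sStar l α
  have hs0 : 0 < s := zero_lt_one.trans hs
  set B := blaschkeFactor l s
  have hB : 0 ≤ B ^ (2 * N) := (even_two_mul N).pow_nonneg B
  have hx : s ^ (-2 : ℤ) = (s ^ 2)⁻¹ := by
    rw [zpow_neg]; norm_cast
  have hs2 : 1 < s ^ 2 := by nlinarith
  have hs21 : 0 < s ^ 2 - 1 := by linarith
  rw [hx]
  set x := (s ^ 2)⁻¹
  have hx0 : 0 < x := by positivity
  have hx1 : x < 1 := inv_lt_one_of_one_lt₀ hs2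
  have hpoly := le_rpow_mul_polylog (n := n) hβ hx0.le hx1
  set P := ((n : ℝ) + 1) ^ β * polylog β x
  -- With `x = s⁻²` one has `s² - 1 = s² (1 - x)`, so the `s⁴` in the numerator cancels.
  have e : s ^ (2 * (2 - (K : ℤ))) / (N * (s ^ 2 - 1) ^ 2) = x ^ K / (1 - x) ^ 2 / N := by
    have e1 : s ^ (2 * (2 - (K : ℤ))) = s ^ 4 * x ^ K := by
      rw [mul_sub, zpow_sub₀ hs0.ne', zpow_mul s 2 (K : ℤ)]
      simp only [x]
      rw [inv_pow]
      norm_cast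
    have e2 : 1 - x = (s ^ 2 - 1) / s ^ 2 := by
      simp only [x]; field_simp
    rw [e1, e2]
    field_simp
  rw [e]
  have hT : B ^ (2 * N) * (x ^ K * (x / (1 - x) ^ 2)) ≤ B ^ (2 * N) * P * (x ^ K / (1 - x) ^ 2) := by
    rw [mul_assoc]
    refine mul_le_mul_of_nonneg_left ?_ hB
    calc x ^ K * (x / (1 - x) ^ 2) = x * (x ^ K / (1 - x) ^ 2) := by ring
      _ ≤ _ := mul_le_mul_of_nonneg_right hpoly (by positivity)
  have hKI : K * I ≤ N / α * I := mul_le_mul_of_nonneg_right hK hI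
  have hfin : (N : ℝ) - n - B ^ (2 * N) * P * (x ^ K / (1 - x) ^ 2) ≤ N / α * I := by linarith
  calc _ = α / N * ((N : ℝ) - n - B ^ (2 * N) * P * (x ^ K / (1 - x) ^ 2)) := by
        simp only [P]
        field_simp
    _ ≤ α / N * (N / α * I) := mul_le_mul_of_nonneg_left hfin (by positivity)
    _ = I := by field_simp

end BlaschkeApprox

theorem theorem3 (n N : ℕ) (hnN : n < N) (f : ℂ → ℂ)
    (hf : BlaschkeApprox.IsBlaschkeProduct N f)
    (l : ℝ) (hl0 : 0 < l) (hl1 : l < 1)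
    (hzeros : ∀ z : ℂ, ‖z‖ < 1 → f z = 0 → ‖z‖ ≤ l)
    (α : ℝ) (hα0 : 0 < α) (hα1 : α < (1 - l) / (1 + l)) :
    1 < BlaschkeApprox.sStar l α ∧ BlaschkeApprox.sStar l α < 1 / l ∧
    (⨆ (β : ℝ) (_ : β ∈ Set.Icc (0 : ℝ) 1)
        (_ : 0 ≤ BlaschkeApprox.radicand n N l α β),
      ENNReal.ofReal (Real.sqrt (BlaschkeApprox.radicand n N l α β)))
    ≤ BlaschkeApprox.d₂ f (BlaschkeApprox.ratFun n n) := by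
  have hs1 := BlaschkeApprox.one_lt_sStar hl0 hl1 hα0 hα1
  have hsl := BlaschkeApprox.sStar_lt_inv hl0 hl1 hα0
  refine ⟨hs1, hsl, iSup_le fun β => iSup_le fun hβ => iSup_le fun _ =>
    le_iInf₂ fun r hr => ?_⟩
  obtain ⟨c, ζ, hc, hζ, hfz⟩ := hf
  -- Each parameter `ζ i` is itself a zero of `f` in the disk.
  have hζl : ∀ i, ‖ζ i‖ ≤ l := fun i => hzeros _ (hζ i) (by
    rw [hfz _ (hζ i).le, Finset.prod_eq_zero (Finset.mem_univ i) (by simp), mul_zero])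
  have hfc : ContinuousOn f (Metric.sphere 0 1) := by
    have h : ContinuousOn (fun z => c * ∏ i, BlaschkeApprox.diskFactor (ζ i) z)
        (Metric.sphere 0 1) :=
      continuousOn_const.mul (continuousOn_finsetProd _ fun i _ z hz =>
        (BlaschkeApprox.differentiableAt_diskFactor (by
          rw [mem_sphere_zero_iff_norm.1 hz, mul_one]
          exact hζ i)).continuousAt.continuousWithinAt)
    exact h.congr fun z hz => hfz z (mem_sphere_zero_iff_norm.1 hz).le
  have hrc := (BlaschkeApprox.exists_fourierCoeff_mul_eq_zero hr).1
  rw [BlaschkeApprox.normL2_eq (g := fun z => f z - r z) (hfc.sub hrc)]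
  refine ENNReal.ofReal_le_ofReal (Real.sqrt_le_sqrt ?_)
  refine BlaschkeApprox.radicand_le (Nat.zero_lt_of_lt hnN) hl0 hl1 hα0 hα1 hβ.1
    (MeasureTheory.integral_nonneg fun _ => by positivity) ?_
  exact BlaschkeApprox.sub_le_mul_integral_add hc hl1 hζl (fun z hz => hfz z hz.le) hr hs1
    (by rwa [lt_div_iff₀' hl0] at hsl) _
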